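/- Let $\mathcal{T}$ be either the category of topological spaces and continuous maps, with ordinary homotopies, or the category of well-pointed topological spaces (the inclusion of the base point is a closed cofibration) and base-point-preserving continuous maps, with homotopies that are stationary at the base point. Write $\simeq$ for homotopy of maps in $\mathcal{T}$. A square $$f\circ q\simeq \iota\circ p,\qquad q\colon P\to X,\quad p\colon P\to A,\quad f\colon X\to Y,\quad \iota\colon A\to Y$$ in $\mathcal{T}$ is a homotopy pullback if, for some homotopy $H$ from $f\circ q$ to $\iota\circ p$, the map $z\mapsto (q(z),H(-,z),p(z))$ from $P$ to the space of triples $(x,\gamma,a)\in X\times Y^{[0,1]}\times A$ with $\gamma(0)=f(x)$ and $\gamma(1)=\iota(a)$ is a homotopy equivalence in $\mathcal{T}$. Let $\mathrm{secat}$ be an abstract sectional category on $\mathcal{T}$, that is, a function that assigns to each map $\iota\colon A\to Y$ of $\mathcal{T}$ a value $\mathrm{secat}(\iota)\in\{0,1,2,\dots\}\cup\{\infty\}$ such that: - (S0) $\mathrm{secat}(\iota)=0$ if and only if there is a map $s\colon Y\to A$ in $\mathcal{T}$ with $\iota\circ s\simeq \mathrm{id}_Y$; - (S1) if $\iota\colon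 A\to X$, $\kappa\colon B\to X$ and $\zeta\colon B\to A$ are maps in $\mathcal{T}$ with $\iota\circ\zeta\simeq\kappa$, then $\mathrm{secat}(\iota)\le\mathrm{secat}(\kappa)$; - (S2) for every homotopy pullback as above, $\mathrm{secat}(q)\le\mathrm{secat}(\iota)$. For maps $f\colon X\to Y$ and $\iota\colon A\to Y$ in $\mathcal{T}$, let $\mathrm{liftcat}_f(\iota)=\mathrm{secat}(q)$, where $q\colon P\to X$ is the map of a homotopy pullback of $f$ and $\iota$ (by (S1) the choice does not matter). For maps $f,g\colon X\to Y$ in $\mathcal{T}$, the homotopic distance is $D(f,g)=\mathrm{liftcat}_{(f,g)}(\Delta)$, where $(f,g)\colon X\to Y\times Y$ and $\Delta\colon Y\to Y\times Y$ is the diagonal. Then, for all maps $f,g\colon X\to Y$ in $\mathcal{T}$: 1. $D(f,g)=0$ if and only if $f\simeq g$; 2. $D(f,g)=D(g,f)$. -/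

import Mathlib

open scoped unitInterval ContinuousMap

universe u

noncomputable section

namespace LiftCat

/-! ### Homotopy pullbacks and abstract sectional category for topological spaces -/

section Free

variable {X Y A P : Type u} [TopologicalSpace X] [TopologicalSpace Y] [TopologicalSpace A]
  [TopologicalSpace P]

/-- The standard homotopy pullback of `f : X → Y` and `ι : A → Y`: the space of triples
`(x, γ, a)` where `γ` is a path in `Y` from `f x` to `ι a`. -/
abbrev StdPullback (f : C(X, Y)) (ι : C(A, Y)) : Type u :=
  {z : X × C(I, Y) × A // z.2.1 0 = f z.1 ∧ z.2.1 1 = ι z.2.2}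

/-- The projection of the standard homotopy pullback to `X`. -/
def StdPullback.fst (f : C(X, Y)) (ι : C(A, Y)) : C(StdPullback f ι, X) where
  toFun z := z.1.1

/-- A homotopy `H` from `f ∘ q` to `ι ∘ p` induces a map into the standard homotopy pullback,
`z ↦ (q z, H(-, z), p z)`. -/
def whisker {f : C(X, Y)} {ι : C(A, Y)} {q : C(P, X)} {p : C(P, A)}
    (H : (f.comp q).Homotopy (ι.comp p)) : C(P, StdPullback f ι) where
  toFun z := ⟨(q z, ⟨fun t => H (t, z), by fun_prop⟩, p z), by simp, by simp⟩
  continuous_toFun := by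
    refine Continuous.subtype_mk (q.continuous.prodMk (Continuous.prodMk ?_ p.continuous)) _
    refine ContinuousMap.continuous_of_continuous_uncurry _ ?_
    exact H.continuous.comp (continuous_snd.prodMk continuous_fst)

/-- The square with sides `q : P → X`, `p : P → A`, `f : X → Y`, `ι : A → Y` is a homotopy
pullback: it commutes up to a homotopy for which the induced map from `P` to the standard homotopy
pullback is a homotopy equivalence. -/
def IsHomotopyPullback (q : C(P, X)) (p : C(P, A)) (f : C(X, Y)) (ι : C(A, Y)) : Prop :=
  ∃ (H : (f.comp q).Homotopy (ι.comp p)) (e : P ≃ₕ StdPullback f ι), e.toFun = whisker H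

end Free

/-- An abstract sectional category on topological spaces and continuous maps. -/
structure SectionalCategory where
  /-- the number attached to each map -/
  secat : ∀ {A Y : Type u} [TopologicalSpace A] [TopologicalSpace Y], C(A, Y) → ℕ∞
  /-- S0: it vanishes exactly on the maps with a homotopy section. -/
  secat_eq_zero_iff : ∀ {A Y : Type u} [TopologicalSpace A] [TopologicalSpace Y] (ι : C(A, Y)),
    secat ι = 0 ↔ ∃ s : C(Y, A), (ι.comp s).Homotopic (ContinuousMap.id Y)
  /-- S1: monotonicity over a fixed base. -/
  secat_le_of_triangle : ∀ {A B X : Type u} [TopologicalSpace A] [TopologicalSpace B]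
    [TopologicalSpace X] (ι : C(A, X)) (κ : C(B, X)) (ζ : C(B, A)),
    (ι.comp ζ).Homotopic κ → secat ι ≤ secat κ
  /-- S2: monotonicity under base change. -/
  secat_le_of_isHomotopyPullback : ∀ {P X Y A : Type u} [TopologicalSpace P] [TopologicalSpace X]
    [TopologicalSpace Y] [TopologicalSpace A] (q : C(P, X)) (p : C(P, A)) (f : C(X, Y))
    (ι : C(A, Y)), IsHomotopyPullback q p f ι → secat q ≤ secat ι

namespace SectionalCategory

variable (S : SectionalCategory.{u}) {X Y A P : Type u} [TopologicalSpace X] [TopologicalSpace Y]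
  [TopologicalSpace A] [TopologicalSpace P]

/-- The lifting category from `f` to `ι`: the sectional category of the base change of `ι`
along `f` in the standard homotopy pullback. -/
def liftcat (f : C(X, Y)) (ι : C(A, Y)) : ℕ∞ := S.secat (StdPullback.fst f ι)

/-- The lifting category may be computed with any homotopy pullback. -/
theorem liftcat_eq_secat {q : C(P, X)} {p : C(P, A)} {f : C(X, Y)} {ι : C(A, Y)}
    (h : IsHomotopyPullback q p f ι) : S.liftcat f ι = S.secat q := by
  obtain ⟨H, e, he⟩ := h
  have hq : (StdPullback.fst f ι).comp e.toFun = q := by rw [he]; rfl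
  refine le_antisymm (S.secat_le_of_triangle _ _ e.toFun (hq ▸ .refl _))
    (S.secat_le_of_triangle _ _ e.invFun ?_)
  have := (ContinuousMap.Homotopic.refl (StdPullback.fst f ι)).comp e.right_inv
  rwa [← ContinuousMap.comp_assoc, hq, ContinuousMap.comp_id] at this

/-- The homotopic distance, i.e. the lifting category from `(f, g) : X → Y × Y` to the diagonal. -/
def homDist (f g : C(X, Y)) : ℕ∞ :=
  S.liftcat (f.prodMk g) ((ContinuousMap.id Y).prodMk (ContinuousMap.id Y))

end SectionalCategory

/-! ### Well-pointed spaces -/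

/-- Homotopy extension property of `i : A → X`. -/
def IsCofibration {A X : Type u} [TopologicalSpace A] [TopologicalSpace X] (i : C(A, X)) : Prop :=
  ∀ (Z : Type u) [TopologicalSpace Z] (g : C(X, Z)) (H : C(I × A, Z)),
    (∀ a, H (0, a) = g (i a)) →
    ∃ G : C(I × X, Z), (∀ x, G (0, x) = g x) ∧ ∀ t a, G (t, i a) = H (t, a)

/-- The inclusion of the point `x₀` in `X` is a closed cofibration. -/
def IsWellPointed {X : Type u} [TopologicalSpace X] (x₀ : X) : Prop :=
  IsClosed ({x₀} : Set X) ∧ IsCofibration (ContinuousMap.const PUnit.{u + 1} x₀)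

/-- A well-pointed space is one whose base point has a halo function `v` and a deformation `h` which brings
`x` to the base point by the time `v x`. -/
theorem isWellPointed_iff {X : Type u} [TopologicalSpace X] (x₀ : X) :
    IsWellPointed x₀ ↔ ∃ (v : C(X, ℝ)) (h : C(I × X, X)), v x₀ = 0 ∧ (∀ x, 0 ≤ v x) ∧
      (∀ x, h (0, x) = x) ∧ ∀ (t : I) x, v x ≤ t → h (t, x) = x₀ := by
  constructor
  · rintro ⟨hc, hcof⟩
    obtain ⟨G, hG0, hG1⟩ := hcof {z : I × X // z.1 = 0 ∨ z.2 = x₀} ⟨fun x => ⟨(0, x), .inl rfl⟩, by fun_prop⟩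
      ⟨fun z => ⟨(z.1, x₀), .inr rfl⟩, by fun_prop⟩ (fun a => rfl)
    have hG1' : ∀ t, G (t, x₀) = ⟨(t, x₀), .inr rfl⟩ := fun t => hG1 t PUnit.unit
    let F : C(X, C(I, ℝ)) := ContinuousMap.curry
      ⟨fun z : X × I => (z.2 : ℝ) - ((G (z.2, z.1)).1.1 : ℝ), by fun_prop⟩
    have hF : ∀ x t, F x t = (t : ℝ) - ((G (t, x)).1.1 : ℝ) := fun x t => rfl
    have key : ∀ (t : I) x, ‖F x‖ < t → (G (t, x)).1.2 = x₀ := by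
      intro t x htx
      rcases (G (t, x)).2 with h0 | h0
      · have h1 := (F x).norm_coe_le_norm t
        rw [hF, h0] at h1
        have := t.2.1
        simp [abs_of_nonneg this] at h1
        exact absurd htx (not_lt.2 h1)
      · exact h0
    have hzero : ∀ x, ‖F x‖ = 0 → x = x₀ := by
      intro x hx
      have hcl : IsClosed {t : I | (G (t, x)).1.2 = x₀} :=
        hc.preimage (f := fun t : I => (G (t, x)).1.2) (by fun_prop)
      have hsub : Set.Ioi (0 : I) ⊆ {t : I | (G (t, x)).1.2 = x₀} := fun t ht =>
        key t x (by rw [hx]; exact_mod_cast ht)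
      have h0 : (0 : I) ∈ closure (Set.Ioi (0 : I)) := by
        rw [closure_Ioi' ⟨1, by simp⟩]; exact Set.self_mem_Ici
      have := hcl.closure_subset_iff.2 hsub h0
      simpa [hG0 x] using this
    refine ⟨⟨fun x => 2 * ‖F x‖, by fun_prop⟩, ⟨fun z => (G z).1.2, by fun_prop⟩, ?_, ?_, ?_, ?_⟩
    · have : F x₀ = 0 := by ext t; rw [hF, hG1']; simp
      simp [this]
    · intro x; simp
    · intro x; simp [hG0]
    · intro t x htx
      simp only [ContinuousMap.coe_mk] at htx ⊢
      rcases (norm_nonneg (F x)).eq_or_lt with h0 | h0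
      · rw [hzero x h0.symm, hG1']
      · exact key t x (by linarith)
  · rintro ⟨v, h, hv0, hv, hh0, hh1⟩
    have hvz : ∀ x, v x = 0 → x = x₀ := fun x hx => by
      rw [← hh0 x]; exact hh1 0 x (by simp [hx])
    refine ⟨?_, ?_⟩
    · have : ({x₀} : Set X) = v ⁻¹' {0} := by
        ext x; exact ⟨fun hx => by rw [Set.mem_singleton_iff.1 hx]; exact hv0, hvz x⟩
      rw [this]; exact isClosed_singleton.preimage v.continuous
    · intro Z _ g H hH
      refine ⟨⟨fun z => if (z.1 : ℝ) ≤ v z.2 then g (h z) else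
        H (Set.projIcc 0 1 zero_le_one ((z.1 : ℝ) - v z.2), PUnit.unit), ?_⟩, ?_, ?_⟩
      · refine Continuous.if_le (by fun_prop) ?_ (by fun_prop) (by fun_prop) ?_
        · exact H.continuous.comp ((continuous_projIcc.comp (by fun_prop)).prodMk continuous_const)
        · rintro ⟨t, x⟩ htx
          simp only at htx
          rw [hh1 t x htx.ge, htx, sub_self, Set.projIcc_left]
          exact (hH PUnit.unit).symm
      · intro x; simp [hv x, hh0]
      · rintro t ⟨⟩
        simp only [ContinuousMap.const_apply, ContinuousMap.coe_mk, hv0, sub_zero,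
          Set.projIcc_val]
        split_ifs with ht
        · have : t = 0 := le_antisymm (by exact_mod_cast ht) t.2.1
          rw [this, hh0]; exact (hH PUnit.unit).symm
        · rfl

/-- A well-pointed topological space. -/
structure WPSpace : Type (u + 1) where
  /-- the underlying space -/
  carrier : Type u
  /-- its topology -/
  [top : TopologicalSpace carrier]
  /-- the base point -/
  pt : carrier
  /-- its inclusion is a closed cofibration -/
  isWellPointed : IsWellPointed pt

instance : CoeSort WPSpace.{u} (Type u) := ⟨WPSpace.carrier⟩

instance (X : WPSpace.{u}) : TopologicalSpace X := X.top

/-- A continuous map preserving base points. -/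
@[ext]
structure WPMap (X Y : WPSpace.{u}) where
  /-- the underlying continuous map -/
  map : C(X, Y)
  /-- it preserves the base points -/
  map_pt : map X.pt = Y.pt

namespace WPMap

variable {X Y Z : WPSpace.{u}}

/-- The identity map. -/
def id (X : WPSpace.{u}) : WPMap X X := ⟨.id X, rfl⟩

/-- Composition of pointed maps. -/
def comp (g : WPMap Y Z) (f : WPMap X Y) : WPMap X Z :=
  ⟨g.map.comp f.map, by simp [f.map_pt, g.map_pt]⟩

/-- Pointed homotopies, i.e. homotopies which are stationary at the base point. -/
abbrev Homotopy (f g : WPMap X Y) : Type u := f.map.HomotopyRel g.map {X.pt}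

/-- Two pointed maps are homotopic through pointed maps. -/
def Homotopic (f g : WPMap X Y) : Prop := Nonempty (Homotopy f g)

/-- `f` is a pointed homotopy equivalence. -/
def IsHomotopyEquiv (f : WPMap X Y) : Prop :=
  ∃ g : WPMap Y X, (g.comp f).Homotopic (id X) ∧ (f.comp g).Homotopic (id Y)

end WPMap

namespace WPSpace

/-- The product of two well-pointed spaces. -/
def prod (X Y : WPSpace.{u}) : WPSpace.{u} where
  carrier := X × Y
  pt := (X.pt, Y.pt)
  isWellPointed := by
    obtain ⟨v, h, hv0, hv, hh0, hh1⟩ := (isWellPointed_iff _).1 X.isWellPointed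
    obtain ⟨w, k, hw0, hw, hk0, hk1⟩ := (isWellPointed_iff _).1 Y.isWellPointed
    refine (isWellPointed_iff _).2 ⟨⟨fun z => max (v z.1) (w z.2), by fun_prop⟩,
      ⟨fun z => (h (z.1, z.2.1), k (z.1, z.2.2)), by fun_prop⟩, ?_, ?_, ?_, ?_⟩
    · simp [hv0, hw0]
    · intro x; exact le_max_of_le_left (hv _)
    · intro x; simp [hh0, hk0]
    · intro t x htx
      have := max_le_iff.1 htx
      simp [hh1 t _ this.1, hk1 t _ this.2]

end WPSpace

/-- The pointed map `(f, g) : X → Y × Z`. -/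
def WPMap.prodMk {X Y Z : WPSpace.{u}} (f : WPMap X Y) (g : WPMap X Z) : WPMap X (Y.prod Z) :=
  ⟨f.map.prodMk g.map, Prod.ext f.map_pt g.map_pt⟩

section Pointed

variable {X Y A P : WPSpace.{u}}

/-- The path `[-1, 2] → Y` made of the reverse of `f (h (-, x))`, of `γ`, and of `ι (k (-, a))`. -/
def longPath (f : C(X, Y)) (ι : C(A, Y)) (h : C(I × X, X)) (k : C(I × A, A))
    (z : ℝ × StdPullback f ι) : Y :=
  if z.1 ≤ 0 then f (h (Set.projIcc 0 1 zero_le_one (-z.1), z.2.1.1))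
  else if z.1 ≤ 1 then z.2.1.2.1 (Set.projIcc 0 1 zero_le_one z.1)
  else ι (k (Set.projIcc 0 1 zero_le_one (z.1 - 1), z.2.1.2.2))

theorem continuous_longPath (f : C(X, Y)) (ι : C(A, Y)) (h : C(I × X, X))
    (k : C(I × A, A)) (hh : ∀ x, h (0, x) = x) (hk : ∀ a, k (0, a) = a) :
    Continuous (longPath f ι h k) := by
  have hp : Continuous (Set.projIcc (0 : ℝ) 1 zero_le_one) := continuous_projIcc
  refine Continuous.if_le (by fun_prop) (Continuous.if_le (by fun_prop) (by fun_prop)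
    (by fun_prop) (by fun_prop) ?_) (by fun_prop) (by fun_prop) ?_
  · rintro ⟨r, z⟩ hr
    simp only at hr
    subst hr
    simp [hk, z.2.2]
  · rintro ⟨r, z⟩ hr
    simp only at hr
    subst hr
    simp [hh, z.2.1]

/-- The standard homotopy pullback of two pointed maps between well-pointed spaces, based at the
constant path. -/
def WPSpace.stdPullback (f : WPMap X Y) (ι : WPMap A Y) : WPSpace.{u} where
  carrier := StdPullback f.map ι.map
  pt := ⟨(X.pt, .const _ Y.pt, A.pt), f.map_pt.symm, ι.map_pt.symm⟩
  isWellPointed := by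
    obtain ⟨v, h, hv0, hv, hh0, hh1⟩ := (isWellPointed_iff _).1 X.isWellPointed
    obtain ⟨w, k, hw0, hw, hk0, hk1⟩ := (isWellPointed_iff _).1 A.isWellPointed
    obtain ⟨m, l, hm0, hm, hl0, hl1⟩ := (isWellPointed_iff _).1 Y.isWellPointed
    have hhp : ∀ t, h (t, X.pt) = X.pt := fun t => hh1 t _ (by rw [hv0]; exact t.2.1)
    have hkp : ∀ t, k (t, A.pt) = A.pt := fun t => hk1 t _ (by rw [hw0]; exact t.2.1)
    have hlp : ∀ t, l (t, Y.pt) = Y.pt := fun t => hl1 t _ (by rw [hm0]; exact t.2.1)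
    have hK := continuous_longPath f.map ι.map h k hh0 hk0
    have hpr : Continuous (Set.projIcc (0 : ℝ) 1 zero_le_one) := continuous_projIcc
    -- the largest value of `m` along the long path
    let F : C(StdPullback f.map ι.map, C(I, ℝ)) := ContinuousMap.curry
      ⟨fun z => m (longPath f.map ι.map h k (3 * (z.2 : ℝ) - 1, z.1)), by fun_prop⟩
    have hF : ∀ e (r : ℝ), -1 ≤ r → r ≤ 2 → m (longPath f.map ι.map h k (r, e)) ≤ ‖F e‖ := by
      intro e r h1 h2
      have := (le_abs_self _).trans
        ((F e).norm_coe_le_norm ⟨(r + 1) / 3, by linarith, by linarith⟩)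
      have h3 : 3 * ((r + 1) / 3) - 1 = r := by ring
      simpa [F, h3] using this
    have hend0 : ∀ (t : I) e, longPath f.map ι.map h k (-t, e) = f.map (h (t, e.1.1)) := by
      intro t e
      have : (-(t : ℝ)) ≤ 0 := neg_nonpos.2 t.2.1
      simp [longPath, this]
    have hend1 : ∀ (t : I) e, longPath f.map ι.map h k (1 + t, e) = ι.map (k (t, e.1.2.2)) := by
      intro t e
      have h0 := t.2.1
      have h1 : ¬ (1 + (t : ℝ)) ≤ 0 := by linarith
      rcases h0.eq_or_lt with ht | ht
      · have ht' : t = 0 := Subtype.ext ht.symm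
        subst ht'
        simp [longPath, hk0, e.2.2]
      · have h2 : ¬ (1 + (t : ℝ)) ≤ 1 := by linarith
        simp only [longPath, h1, h2, if_false, add_sub_cancel_left, Set.projIcc_val]
    let d : StdPullback f.map ι.map → ℝ := fun e => max (v e.1.1) (w e.1.2.2)
    have hd : Continuous d := by fun_prop
    let c : I × StdPullback f.map ι.map → I := fun z =>
      Set.projIcc 0 1 zero_le_one ((z.1 : ℝ) - d z.2)
    have hc : Continuous c := by fun_prop
    have hc0 : ∀ z, (z.1 : ℝ) ≤ d z.2 → c z = 0 := fun z hz =>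
      Set.projIcc_of_le_left _ (by linarith)
    let D : C(I × StdPullback f.map ι.map, C(I, Y)) := ContinuousMap.curry
      ⟨fun z => l (c z.1, longPath f.map ι.map h k
        ((z.2 : ℝ) * (1 + 2 * (z.1.1 : ℝ)) - z.1.1, z.1.2)), by fun_prop⟩
    have hD : ∀ z τ, D z τ = l (c z, longPath f.map ι.map h k
      ((τ : ℝ) * (1 + 2 * (z.1 : ℝ)) - z.1, z.2)) := fun z τ => rfl
    have hD0 : ∀ z, D z 0 = f.map (h (z.1, z.2.1.1)) := by
      rintro ⟨t, e⟩
      rw [hD]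
      simp only [Set.Icc.coe_zero, zero_mul, zero_sub, hend0]
      rcases le_total (t : ℝ) (d e) with hle | hle
      · rw [hc0 _ hle, hl0]
      · rw [hh1 t _ ((le_max_left _ _).trans hle), f.map_pt, hlp]
    have hD1 : ∀ z, D z 1 = ι.map (k (z.1, z.2.1.2.2)) := by
      rintro ⟨t, e⟩
      rw [hD]
      have : (1 : ℝ) * (1 + 2 * (t : ℝ)) - t = 1 + t := by ring
      simp only [Set.Icc.coe_one, this, hend1]
      rcases le_total (t : ℝ) (d e) with hle | hle
      · rw [hc0 _ hle, hl0]
      · rw [hk1 t _ ((le_max_right _ _).trans hle), ι.map_pt, hlp]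
    refine (isWellPointed_iff _).2 ⟨⟨fun e => d e + ‖F e‖, by fun_prop⟩,
      ⟨fun z => ⟨(h (z.1, z.2.1.1), D z, k (z.1, z.2.1.2.2)), hD0 z, hD1 z⟩, ?_⟩, ?_, ?_, ?_, ?_⟩
    · exact Continuous.subtype_mk (by fun_prop) _
    · have : F ⟨(X.pt, .const _ Y.pt, A.pt), f.map_pt.symm, ι.map_pt.symm⟩ = 0 := by
        ext t
        simp [F, longPath, hhp, hkp, f.map_pt, ι.map_pt, hm0]
      simp [d, hv0, hw0, this]
    · intro e
      exact add_nonneg (le_max_of_le_left (hv _)) (norm_nonneg _)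
    · intro e
      refine Subtype.ext (Prod.ext (hh0 _) (Prod.ext (ContinuousMap.ext fun τ => ?_) (hk0 _)))
      change D (0, e) τ = e.1.2.1 τ
      rw [hD, hc0 _ (le_max_of_le_left (hv _)), hl0]
      have h1 := τ.2.1
      have h2 := τ.2.2
      simp only [Set.Icc.coe_zero, mul_zero, add_zero, mul_one, sub_zero, longPath, h2, if_true,
        Set.projIcc_val]
      split_ifs with h0
      · have : τ = 0 := Subtype.ext (le_antisymm h0 h1)
        subst this
        simp [hh0, e.2.1]
      · rfl
    · intro t e hte
      simp only [ContinuousMap.coe_mk] at hte ⊢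
      have hdt : d e ≤ t := le_trans (by simp) hte
      refine Subtype.ext (Prod.ext (hh1 _ _ ((le_max_left _ _).trans hdt))
        (Prod.ext (ContinuousMap.ext fun τ => ?_) (hk1 _ _ ((le_max_right _ _).trans hdt))))
      change D (t, e) τ = Y.pt
      rw [hD]
      have ht0 := t.2.1
      have ht1 := t.2.2
      have h0 := τ.2.1
      have h1 := τ.2.2
      refine hl1 _ _ ((hF e _ (by nlinarith) (by nlinarith)).trans ?_)
      have hdn : 0 ≤ d e := le_max_of_le_left (hv _)
      have : c (t, e) = ⟨(t : ℝ) - d e, by linarith, by linarith⟩ :=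
        Set.projIcc_of_mem zero_le_one ⟨by linarith, by linarith⟩
      rw [this]
      change ‖F e‖ ≤ (t : ℝ) - d e
      linarith

/-- The projection of the standard homotopy pullback to `X`. -/
def WPSpace.stdPullbackFst (f : WPMap X Y) (ι : WPMap A Y) :
    WPMap (WPSpace.stdPullback f ι) X :=
  ⟨StdPullback.fst f.map ι.map, rfl⟩

/-- A pointed homotopy `H` from `f ∘ q` to `ι ∘ p` induces a pointed map into the standard homotopy
pullback, `z ↦ (q z, H(-, z), p z)`. -/
def WPMap.whisker {f : WPMap X Y} {ι : WPMap A Y} {q : WPMap P X} {p : WPMap P A}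
    (H : (f.comp q).Homotopy (ι.comp p)) : WPMap P (WPSpace.stdPullback f ι) where
  map := LiftCat.whisker H.toHomotopy
  map_pt := by
    refine Subtype.ext (Prod.ext q.map_pt (Prod.ext (ContinuousMap.ext fun t => ?_) p.map_pt))
    exact (H.eq_fst t rfl).trans (f.comp q).map_pt

/-- Homotopy pullback squares of well-pointed spaces. -/
def IsWPHomotopyPullback (q : WPMap P X) (p : WPMap P A) (f : WPMap X Y) (ι : WPMap A Y) : Prop :=
  ∃ H : (f.comp q).Homotopy (ι.comp p), (WPMap.whisker H).IsHomotopyEquiv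

end Pointed

/-- An abstract sectional category on well-pointed spaces and pointed continuous maps. -/
structure WPSectionalCategory where
  /-- the number attached to each map -/
  secat : ∀ {A Y : WPSpace.{u}}, WPMap A Y → ℕ∞
  /-- S0: it vanishes exactly on the maps with a homotopy section. -/
  secat_eq_zero_iff : ∀ {A Y : WPSpace.{u}} (ι : WPMap A Y),
    secat ι = 0 ↔ ∃ s : WPMap Y A, (ι.comp s).Homotopic (WPMap.id Y)
  /-- S1: monotonicity over a fixed base. -/
  secat_le_of_triangle : ∀ {A B X : WPSpace.{u}} (ι : WPMap A X) (κ : WPMap B X) (ζ : WPMap B A),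
    (ι.comp ζ).Homotopic κ → secat ι ≤ secat κ
  /-- S2: monotonicity under base change. -/
  secat_le_of_isHomotopyPullback : ∀ {P X Y A : WPSpace.{u}} (q : WPMap P X) (p : WPMap P A)
    (f : WPMap X Y) (ι : WPMap A Y), IsWPHomotopyPullback q p f ι → secat q ≤ secat ι

namespace WPSectionalCategory

variable (S : WPSectionalCategory.{u}) {X Y A P : WPSpace.{u}}

/-- The lifting category from `f` to `ι`: the sectional category of the base change of `ι`
along `f` in the standard homotopy pullback. -/
def liftcat (f : WPMap X Y) (ι : WPMap A Y) : ℕ∞ := S.secat (WPSpace.stdPullbackFst f ι)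

/-- The lifting category may be computed with any homotopy pullback. -/
theorem liftcat_eq_secat {q : WPMap P X} {p : WPMap P A} {f : WPMap X Y} {ι : WPMap A Y}
    (h : IsWPHomotopyPullback q p f ι) : S.liftcat f ι = S.secat q := by
  obtain ⟨H, v, -, hv⟩ := h
  refine le_antisymm (S.secat_le_of_triangle _ _ (WPMap.whisker H) ⟨.refl _ _⟩)
    (S.secat_le_of_triangle _ _ v ?_)
  exact ContinuousMap.HomotopicRel.comp_continuousMap hv (WPSpace.stdPullbackFst f ι).map

/-- The homotopic distance, i.e. the lifting category from `(f, g) : X → Y × Y` to the diagonal. -/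
def homDist (f g : WPMap X Y) : ℕ∞ :=
  S.liftcat (f.prodMk g) ((WPMap.id Y).prodMk (WPMap.id Y))

end WPSectionalCategory

end LiftCat

end

/-! The standard homotopy pullback is weakly universal: any square with `f ∘ q ≃ ι ∘ p` yields,
through its homotopy, a map `whisker H` into it whose first projection is exactly `q`. By S1,
`liftcat f ι ≤ secat q` for every homotopy commutative square, whether or not it is a homotopy
pullback (`liftcat_le_secat`).

With S0 this gives `liftcat_eq_zero_iff`: a homotopy section of the projection to `X` is carried to
`A` by the other projection and becomes a homotopy lift of `f`; conversely, a lift is a square whose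
side `q` is the identity, and `secat (id) = 0`.

For the diagonal, a homotopy lift of `(f, g)` is one map homotopic to both `f` and `g`, which is
claim 1. For claim 2, the coordinate swap of `Y × Y` fixes the diagonal, so it turns the square for
`(g, f)` into one for `(f, g)` with the same `q`. The pointed case is the same argument with all
homotopies stationary at the base point. -/

namespace LiftCat

/-! ### Topological spaces and free homotopies. -/

section Free

variable {X Y A P : Type u} [TopologicalSpace X] [TopologicalSpace Y] [TopologicalSpace A]
  [TopologicalSpace P]

/-- The projection of the standard homotopy pullback to `A`. -/
def StdPullback.snd (f : C(X, Y)) (ι : C(A, Y)) : C(StdPullback f ι, A) where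
  toFun z := z.1.2.2

/-- The standard homotopy pullback square commutes up to the homotopy `(t, (x, γ, a)) ↦ γ t`. -/
def StdPullback.homotopy (f : C(X, Y)) (ι : C(A, Y)) :
    (f.comp (StdPullback.fst f ι)).Homotopy (ι.comp (StdPullback.snd f ι)) where
  toFun z := z.2.1.2.1 z.1
  continuous_toFun := by fun_prop
  map_zero_left z := z.2.1
  map_one_left z := z.2.2

namespace SectionalCategory

variable (S : SectionalCategory.{u})

/-- Every homotopy commutative square bounds the lifting category. -/
theorem liftcat_le_secat {q : C(P, X)} {p : C(P, A)} {f : C(X, Y)} {ι : C(A, Y)}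
    (h : (f.comp q).Homotopic (ι.comp p)) : S.liftcat f ι ≤ S.secat q := by
  obtain ⟨H⟩ := h
  exact S.secat_le_of_triangle _ _ (whisker H) (.refl _)

/-- The lifting category vanishes exactly when `f` lifts through `ι` up to homotopy. -/
theorem liftcat_eq_zero_iff (f : C(X, Y)) (ι : C(A, Y)) :
    S.liftcat f ι = 0 ↔ ∃ s : C(X, A), f.Homotopic (ι.comp s) := by
  constructor
  · intro h
    obtain ⟨s, hs⟩ := (S.secat_eq_zero_iff _).1 h
    have hsq : (f.comp (StdPullback.fst f ι)).Homotopic (ι.comp (StdPullback.snd f ι)) :=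
      ⟨StdPullback.homotopy f ι⟩
    -- The chain is `f ≃ f ∘ fst ∘ s ≃ ι ∘ snd ∘ s`.
    exact ⟨(StdPullback.snd f ι).comp s,
      ((ContinuousMap.Homotopic.refl f).comp hs).symm.trans (hsq.comp (.refl s))⟩
  · rintro ⟨s, hs⟩
    -- The lift is read as a square with `q = id` and `p = s`.
    have hle : S.liftcat f ι ≤ S.secat (.id X) := S.liftcat_le_secat (p := s) hs
    rwa [(S.secat_eq_zero_iff (.id X)).2 ⟨.id X, .refl _⟩, nonpos_iff_eq_zero] at hle

/-- Projecting a homotopy `(f, g) ≃ Δ ∘ s` to each factor makes `s` a common intermediary.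
Conversely `s = g` works, since `(f, g) ≃ (g, g) = Δ ∘ g`. -/
theorem homDist_eq_zero_iff (f g : C(X, Y)) : S.homDist f g = 0 ↔ f.Homotopic g := by
  refine (S.liftcat_eq_zero_iff _ _).trans ⟨?_, fun h => ⟨g, h.prodMk (.refl g)⟩⟩
  rintro ⟨s, hs⟩
  have h₁ : f.Homotopic s := (ContinuousMap.Homotopic.refl ContinuousMap.fst).comp hs
  have h₂ : g.Homotopic s := (ContinuousMap.Homotopic.refl ContinuousMap.snd).comp hs
  exact h₁.trans h₂.symm

/-- Composing the square for `(g, f)` with the swap replaces `(g, f)` by `(f, g)` and leaves `Δ`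
unchanged, both definitionally. One inequality is enough, as `f` and `g` are arbitrary. -/
theorem homDist_le_swap (f g : C(X, Y)) : S.homDist f g ≤ S.homDist g f :=
  S.liftcat_le_secat (p := StdPullback.snd _ _) <|
    (ContinuousMap.Homotopic.refl ContinuousMap.prodSwap).comp ⟨StdPullback.homotopy _ _⟩

end SectionalCategory

end Free

/-! ### Well-pointed spaces and pointed homotopies. -/

section Pointed

variable {X Y Z A P : WPSpace.{u}}

namespace WPMap

theorem Homotopic.symm {f g : WPMap X Y} (h : f.Homotopic g) : g.Homotopic f :=
  ContinuousMap.HomotopicRel.symm h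

theorem Homotopic.trans {f g k : WPMap X Y} (h : f.Homotopic g) (h' : g.Homotopic k) :
    f.Homotopic k :=
  ContinuousMap.HomotopicRel.trans h h'

theorem Homotopic.refl (f : WPMap X Y) : f.Homotopic f :=
  ContinuousMap.HomotopicRel.refl f.map

theorem Homotopic.postcomp {f g : WPMap X Y} (h : f.Homotopic g) (k : WPMap Y Z) :
    (k.comp f).Homotopic (k.comp g) :=
  ContinuousMap.HomotopicRel.comp_continuousMap h k.map

theorem Homotopic.precomp {f g : WPMap Y Z} (h : f.Homotopic g) (k : WPMap X Y) :
    (f.comp k).Homotopic (g.comp k) := by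
  obtain ⟨H⟩ := h
  refine ⟨⟨H.toHomotopy.comp (.refl k.map), ?_⟩⟩
  rintro t x rfl
  -- Since `k` sends base point to base point, the composite stays where `H` is stationary.
  exact H.eq_fst t k.map_pt

theorem Homotopic.prodMk {f g : WPMap X Y} {f' g' : WPMap X Z} (h : f.Homotopic g)
    (h' : f'.Homotopic g') : (f.prodMk f').Homotopic (g.prodMk g') := by
  obtain ⟨H⟩ := h
  obtain ⟨H'⟩ := h'
  exact ⟨H.prod H'⟩

/-- The first projection of a product of well-pointed spaces. -/
def fst : WPMap (X.prod Y) X := ⟨ContinuousMap.fst, rfl⟩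

/-- The second projection of a product of well-pointed spaces. -/
def snd : WPMap (X.prod Y) Y := ⟨ContinuousMap.snd, rfl⟩

end WPMap

/-- The projection of the standard homotopy pullback to `A`. -/
def WPSpace.stdPullbackSnd (f : WPMap X Y) (ι : WPMap A Y) :
    WPMap (WPSpace.stdPullback f ι) A :=
  ⟨StdPullback.snd f.map ι.map, rfl⟩

/-- The standard homotopy pullback square commutes up to a pointed homotopy. -/
theorem WPSpace.stdPullback_homotopic (f : WPMap X Y) (ι : WPMap A Y) :
    (f.comp (WPSpace.stdPullbackFst f ι)).Homotopic (ι.comp (WPSpace.stdPullbackSnd f ι)) := by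
  refine ⟨⟨StdPullback.homotopy f.map ι.map, ?_⟩⟩
  rintro t x rfl
  -- The path component of the base point is constant at `Y.pt`.
  exact f.map_pt.symm

namespace WPSectionalCategory

variable (S : WPSectionalCategory.{u})

/-- Every homotopy commutative square bounds the lifting category. -/
theorem liftcat_le_secat {q : WPMap P X} {p : WPMap P A} {f : WPMap X Y} {ι : WPMap A Y}
    (h : (f.comp q).Homotopic (ι.comp p)) : S.liftcat f ι ≤ S.secat q := by
  obtain ⟨H⟩ := h
  exact S.secat_le_of_triangle _ _ (WPMap.whisker H) (.refl q)

/-- The lifting category vanishes exactly when `f` lifts through `ι` up to homotopy. -/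
theorem liftcat_eq_zero_iff (f : WPMap X Y) (ι : WPMap A Y) :
    S.liftcat f ι = 0 ↔ ∃ s : WPMap X A, f.Homotopic (ι.comp s) := by
  constructor
  · intro h
    obtain ⟨s, hs⟩ := (S.secat_eq_zero_iff _).1 h
    exact ⟨(WPSpace.stdPullbackSnd f ι).comp s,
      (hs.postcomp f).symm.trans ((WPSpace.stdPullback_homotopic f ι).precomp s)⟩
  · rintro ⟨s, hs⟩
    have hle : S.liftcat f ι ≤ S.secat (.id X) := S.liftcat_le_secat (p := s) hs
    rwa [(S.secat_eq_zero_iff (.id X)).2 ⟨.id X, .refl _⟩, nonpos_iff_eq_zero] at hle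

theorem homDist_eq_zero_iff (f g : WPMap X Y) : S.homDist f g = 0 ↔ f.Homotopic g := by
  refine (S.liftcat_eq_zero_iff _ _).trans ⟨?_, fun h => ⟨g, h.prodMk (.refl g)⟩⟩
  rintro ⟨s, hs⟩
  have h₁ : f.Homotopic s := hs.postcomp WPMap.fst
  have h₂ : g.Homotopic s := hs.postcomp WPMap.snd
  exact h₁.trans h₂.symm

/-- As in the free case; `WPMap.snd.prodMk WPMap.fst` is the swap as a pointed map. -/
theorem homDist_le_swap (f g : WPMap X Y) : S.homDist f g ≤ S.homDist g f :=
  S.liftcat_le_secat (p := WPSpace.stdPullbackSnd _ _) <|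
    (WPSpace.stdPullback_homotopic _ _).postcomp (WPMap.snd.prodMk WPMap.fst)

end WPSectionalCategory

end Pointed

end LiftCat

theorem mainTheorem8 :
    (∀ (S : LiftCat.SectionalCategory.{u}) (X Y : Type u) [TopologicalSpace X] [TopologicalSpace Y]
      (f g : C(X, Y)),
      (S.homDist f g = 0 ↔ f.Homotopic g) ∧ S.homDist f g = S.homDist g f) ∧
    (∀ (S : LiftCat.WPSectionalCategory.{u}) (X Y : LiftCat.WPSpace.{u}) (f g : LiftCat.WPMap X Y),
      (S.homDist f g = 0 ↔ f.Homotopic g) ∧ S.homDist f g = S.homDist g f) := by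
  exact ⟨fun S _ _ _ _ f g => ⟨S.homDist_eq_zero_iff f g,
      le_antisymm (S.homDist_le_swap f g) (S.homDist_le_swap g f)⟩,
    fun S _ _ f g => ⟨S.homDist_eq_zero_iff f g,
      le_antisymm (S.homDist_le_swap f g) (S.homDist_le_swap g f)⟩⟩
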